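/- Let $n\ge 1$ and $\lambda\in(0,n)$. Let $\mathcal P$ be the set of Borel probability measures on $\mathbb{R}^n$, let $\operatorname{supp}\nu$ denote the (closed) support of $\nu\in\mathcal P$, and set $$I_\lambda(\nu)=\int_{\mathbb{R}^n}\int_{\mathbb{R}^n}|x-y|^{-\lambda}\,d\nu(x)\,d\nu(y)\in[0,\infty],$$ $$\mathcal E_{\infty,\lambda}(\nu)=\begin{cases} I_\lambda(\nu) & \text{if } \operatorname{diam}(\operatorname{supp}\nu)\le 1,\\ +\infty & \text{otherwise,}\end{cases}$$ where $|x-y|^{-\lambda}=+\infty$ for $x=y$. For $A\subset\mathbb{R}^n$ the $\lambda$-capacity of $A$ is $$C_\lambda(A)=\Bigl(\inf_{\nu\in\mathcal P}\bigl\{I_\lambda(\nu) : \operatorname{supp}\nu\subset A\bigr\}\Bigr)^{-1}\in[0,\infty],$$ with $\inf\emptyset=\infty$, $\infty^{-1}=0$ and $0^{-1}=\infty$. An equilibrium measure on $A$ is a measure $\mu\in\mathcal P$ with $\operatorname{supp}\mu\subset A$ and $I_\lambda(\mu)\le I_\lambda(\rho)$ for all $\rho\in\mathcal P$ with $\operatorname{supp}\rho\subset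 A$. A convex body is a nonempty compact convex set $W\subset\mathbb{R}^n$; it has constant width $1$ if $\max_{x\in W}\langle u,x\rangle-\min_{x\in W}\langle u,x\rangle=1$ for every unit vector $u$. Then the following hold. 1. $$\inf_{\nu\in\mathcal P}\mathcal E_{\infty,\lambda}(\nu)=\Bigl(\sup_{A\subset\mathbb{R}^n}\bigl\{C_\lambda(A) : \operatorname{diam}(A)\le 1\bigr\}\Bigr)^{-1}.$$ 2. The infimum on the left-hand side is attained for some $\mu\in\mathcal P$ with $\operatorname{diam}(\operatorname{supp}\mu)=1$, and the supremum on the right-hand side is attained for some convex body $W\subset\mathbb{R}^n$ of constant width $1$ containing $\operatorname{supp}\mu$ (in particular, $\operatorname{diam}(W)\le 1$). 3. Conversely, if $W$ is a convex body of constant width $1$ whose $\lambda$-capacity is maximal among all convex bodies of constant width $1$, then an equilibrium measure on $W$ exists, and every equilibrium measure on $W$ attains the infimum of $\mathcal E_{\infty,\lambda}$ over $\mathcal P$. -/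

import Mathlib

open MeasureTheory
open scoped ENNReal

noncomputable section

namespace RieszCapacity

/-- Euclidean `n`-space with its Borel `σ`-algebra and the Euclidean norm. -/
abbrev Space (n : ℕ) : Type := EuclideanSpace ℝ (Fin n)

/-- The Riesz interaction energy `I_λ(ν) = ∫∫ |x - y|^{-λ} dν(x) dν(y)`, with values in `[0, ∞]`.
For `λ > 0` the kernel takes the value `∞` on the diagonal. -/
def rieszEnergy {n : ℕ} (lam : ℝ) (ν : ProbabilityMeasure (Space n)) : ℝ≥0∞ :=
  ∫⁻ x, ∫⁻ y, (edist x y) ^ (-lam) ∂(ν : Measure (Space n)) ∂(ν : Measure (Space n))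

/-- The topological support of a Borel probability measure. -/
def supp {n : ℕ} (ν : ProbabilityMeasure (Space n)) : Set (Space n) :=
  (ν : Measure (Space n)).support

open Classical in
/-- The limiting energy `E_{∞,λ}`: the Riesz energy if the support has diameter at most `1`, and
`+∞` otherwise. -/
def limitEnergy {n : ℕ} (lam : ℝ) (ν : ProbabilityMeasure (Space n)) : ℝ≥0∞ :=
  if Metric.ediam (supp ν) ≤ 1 then rieszEnergy lam ν else ⊤

/-- The `λ`-capacity of `A`: the reciprocal, in `[0, ∞]`, of the infimum of the Riesz energy over
the probability measures whose support is contained in `A`. -/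
def capacity {n : ℕ} (lam : ℝ) (A : Set (Space n)) : ℝ≥0∞ :=
  (⨅ (ν : ProbabilityMeasure (Space n)) (_ : supp ν ⊆ A), rieszEnergy lam ν)⁻¹

/-- `ν` is an equilibrium measure on `A`: it is supported in `A`, and it has the least Riesz energy
among all probability measures supported in `A`. -/
def IsEquilibriumMeasure {n : ℕ} (lam : ℝ) (A : Set (Space n))
    (ν : ProbabilityMeasure (Space n)) : Prop :=
  supp ν ⊆ A ∧
    ∀ ρ : ProbabilityMeasure (Space n), supp ρ ⊆ A → rieszEnergy lam ν ≤ rieszEnergy lam ρ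

/-- The width of a convex body in the direction `u`: for a unit vector `u`, the distance between
the two supporting hyperplanes orthogonal to `u`. -/
def width {n : ℕ} (W : ConvexBody (Space n)) (u : Space n) : ℝ :=
  sSup ((fun x => inner ℝ u x) '' (W : Set (Space n))) -
    sInf ((fun x => inner ℝ u x) '' (W : Set (Space n)))

/-- The convex body `W` has constant width `w`: its width is `w` in every direction. -/
def HasConstantWidth {n : ℕ} (W : ConvexBody (Space n)) (w : ℝ) : Prop :=
  ∀ u : Space n, ‖u‖ = 1 → width W u = w

end RieszCapacity

end

/-! Both sides describe one minimisation: a measure whose support has diameter at most `1` competes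
on its own support, and every set of diameter at most `1` admits only such measures. A minimiser `μ`
exists because translation confines the problem to measures on a fixed ball, which are weakly
compact; the diameter bound is weakly closed (`isClosed_ediam_supp_le`) and the energy is a supremum
of continuous truncations (`lowerSemicontinuous_rieszEnergy`). Since `λ < n` the minimum is finite,
and dilating a support of smaller diameter would lower it.

Any set of diameter at most `1` containing `supp μ` has `μ` as an equilibrium measure, hence maximal
capacity. Such a set can be taken of constant width `1` (`exists_constantWidth_superset`): by Zorn
it lies in a maximal set of diameter at most `1`, and maximality forces constant width. For the
converse, compare a maximal body with this one. -/

namespace RieszCapacity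

open Filter Topology Metric Set
open scoped NNReal

/-! ### Completion to a body of constant width -/

section ConstantWidth

variable {n : ℕ}

/-- Every set of diameter at most `1` is contained in a maximal one. -/
theorem exists_maximal_ediam_le_one (A : Set (Space n)) (hA : ediam A ≤ 1) :
    ∃ W, A ⊆ W ∧ Maximal (· ∈ {B : Set (Space n) | ediam B ≤ 1}) W := by
  refine zorn_subset_nonempty _ (fun c hc hchain _ => ⟨⋃₀ c, ?_, fun s hs => subset_sUnion_of_mem hs⟩)
    A hA
  refine ediam_le ?_
  rintro x ⟨s, hs, hxs⟩ y ⟨t, ht, hyt⟩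
  rcases hchain.total hs ht with h | h
  · exact (edist_le_ediam_of_mem (h hxs) hyt).trans (hc ht)
  · exact (edist_le_ediam_of_mem hxs (h hyt)).trans (hc hs)

theorem norm_sub_le_one_of_ediam_le_one {W : Set (Space n)} (hW : ediam W ≤ 1) {x y : Space n}
    (hx : x ∈ W) (hy : y ∈ W) : ‖x - y‖ ≤ 1 := by
  have h := (edist_le_ediam_of_mem hx hy).trans hW
  rw [edist_dist, ENNReal.ofReal_le_one, dist_eq_norm] at h
  exact h

/-- A maximal set of diameter at most `1` contains every point at distance at most `1` from all of
its points. -/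
theorem mem_of_maximal_ediam_le_one {W : Set (Space n)}
    (hW : Maximal (· ∈ {B : Set (Space n) | ediam B ≤ 1}) W) {z : Space n}
    (hz : ∀ c ∈ W, ‖z - c‖ ≤ 1) : z ∈ W := by
  have hz' : ∀ c ∈ W, edist z c ≤ 1 := fun c hc => by
    rw [edist_dist, ENNReal.ofReal_le_one, dist_eq_norm]
    exact hz c hc
  have h : insert z W ∈ {B : Set (Space n) | ediam B ≤ 1} := by
    refine ediam_le ?_
    rintro x (rfl | hx) y (rfl | hy)
    · simp
    · exact hz' y hy
    · rw [edist_comm]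
      exact hz' x hx
    · exact (edist_le_ediam_of_mem hx hy).trans hW.prop
  exact hW.le_of_ge h (subset_insert z W) (mem_insert z W)

/-- Quantitative form of the fact that a radius-one arc joining `0` to a point outside the unit ball
centred at `-u` rises above the hyperplane orthogonal to `u`. -/
theorem exists_arc_point {x u : Space n} (hu : ‖u‖ = 1) (hxu : inner ℝ u x ≤ 0)
    (hfar : 1 < ‖x + u‖) :
    ∃ z : Space n, 0 < inner ℝ u z ∧ ∀ c : Space n, ‖c‖ ≤ 1 → ‖x - c‖ ≤ 1 → ‖z - c‖ ≤ 1 := by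
  set a : ℝ := inner ℝ u x with ha
  have hgap : 0 < ‖x‖ ^ 2 + 2 * a := by
    have h1 : ‖x + u‖ ^ 2 = ‖x‖ ^ 2 + 2 * a + 1 := by
      rw [norm_add_sq_real, hu, real_inner_comm]; ring
    nlinarith
  set g : ℝ := ‖x‖ ^ 2 + 2 * a with hg
  set q : ℝ := ‖x‖ ^ 2 with hq
  have hq0 : 0 ≤ q := by positivity
  -- The gap `g` is split: `a + b = g / 4` puts the new point above the hyperplane, while `2 * b`
  -- spends only `g / 2` of the gap. The other half absorbs the terms quadratic in `t`.
  set b : ℝ := -a + g / 4 with hb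
  have hb0 : 0 < b := by linarith
  obtain ⟨t, ht0, ht1, htM⟩ : ∃ t : ℝ, 0 < t ∧ t ≤ 1 ∧ t * (q + b ^ 2) ≤ g / 2 := by
    refine ⟨min 1 (g / 2 / (q + b ^ 2)), by positivity, min_le_left _ _, ?_⟩
    have h2 : 0 < q + b ^ 2 := by positivity
    calc min 1 (g / 2 / (q + b ^ 2)) * (q + b ^ 2) ≤ (g / 2 / (q + b ^ 2)) * (q + b ^ 2) := by
          gcongr; exact min_le_right _ _
      _ = g / 2 := by field_simp
  refine ⟨t • x + (t * b) • u, ?_, fun c hc hxc => ?_⟩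
  · rw [inner_add_right, inner_smul_right, inner_smul_right, real_inner_self_eq_norm_sq, hu, ← ha]
    have : t * a + t * b * 1 ^ 2 = t * (g / 4) := by rw [hb]; ring
    rw [this]
    positivity
  · have hcu : -1 ≤ inner ℝ u c := by
      have := abs_real_inner_le_norm u c
      rw [hu, one_mul] at this
      linarith [(abs_le.1 (this.trans hc)).1]
    have e1 : ‖x - c‖ ^ 2 = q - 2 * inner ℝ x c + ‖c‖ ^ 2 := norm_sub_sq_real x c
    have e2 : ‖t • x + (t * b) • u - c‖ ^ 2
        = t ^ 2 * q + 2 * (t * (t * b)) * a + (t * b) ^ 2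
          - 2 * (t * inner ℝ x c + t * b * inner ℝ u c) + ‖c‖ ^ 2 := by
      rw [norm_sub_sq_real, norm_add_sq_real, inner_add_left, inner_smul_left, inner_smul_left,
        inner_smul_left, inner_smul_right, norm_smul, norm_smul, hu, real_inner_comm, ← ha]
      simp only [mul_pow, Real.norm_eq_abs, sq_abs, conj_trivial, mul_one, hq]
      ring
    have hc2 : ‖c‖ ^ 2 ≤ 1 := pow_le_one₀ (norm_nonneg _) hc
    have hxc2 : ‖x - c‖ ^ 2 ≤ 1 := pow_le_one₀ (norm_nonneg _) hxc
    -- The three constraints on `c` enter with weights `1 - t`, `t` and `2 * t * b`, which cancel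
    -- its inner products with `x` and `u`; the remainder is at most `1 - t * g + t * g / 2 + t * g
    -- / 2 = 1`.
    have h1 : 0 ≤ (1 - t) * (1 - ‖c‖ ^ 2) := mul_nonneg (by linarith) (by linarith)
    have h2 : 0 ≤ t * (1 - ‖x - c‖ ^ 2) := mul_nonneg ht0.le (by linarith)
    have h3 : 0 ≤ t * b * (1 + inner ℝ u c) := mul_nonneg (by positivity) (by linarith)
    have h4 : t * (t * (q + b ^ 2)) ≤ t * (g / 2) := by gcongr
    have h5 : t * (t * b) * a ≤ 0 := mul_nonpos_of_nonneg_of_nonpos (by positivity) hxu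
    have h6 : t * b = t * (-a + g / 4) := rfl
    have h7 : t * g = t * q + 2 * (t * a) := by rw [hg]; ring
    rw [e1] at h2
    have : ‖t • x + (t * b) • u - c‖ ^ 2 ≤ 1 := by
      rw [e2]
      nlinarith
    exact (sq_le_one_iff₀ (norm_nonneg _)).1 this

/-- The point of a maximal set of diameter `1` opposite to a support point belongs to the set. -/
theorem sub_mem_of_maximal_ediam_le_one {W : Set (Space n)}
    (hW : Maximal (· ∈ {B : Set (Space n) | ediam B ≤ 1}) W) {p u : Space n} (hu : ‖u‖ = 1)
    (hp : p ∈ W) (hmax : ∀ x ∈ W, inner ℝ u x ≤ inner ℝ u p) : p - u ∈ W := by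
  refine mem_of_maximal_ediam_le_one hW fun x hx => ?_
  by_contra! hfar
  -- With `p` as origin, a point too far from `p - u` yields `z + p`, which maximality puts in `W`
  -- although it lies higher than `p`.
  obtain ⟨z, hz0, hz⟩ := exists_arc_point (x := x - p) hu
    (by rw [inner_sub_right]; linarith [hmax x hx])
    (by rwa [show x - p + u = -(p - u - x) by abel, norm_neg])
  have hzW : z + p ∈ W := by
    refine mem_of_maximal_ediam_le_one hW fun c hc => ?_
    have := hz (c - p) (norm_sub_le_one_of_ediam_le_one hW.prop hc hp)
      (by convert norm_sub_le_one_of_ediam_le_one hW.prop hx hc using 2; abel)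
    convert this using 2
    abel
  have := hmax _ hzW
  rw [inner_add_right] at this
  linarith

/-- Every nonempty set of diameter at most `1` lies in a convex body of constant width `1` whose
diameter is at most `1`. -/
theorem exists_constantWidth_superset {A : Set (Space n)} (hne : A.Nonempty) (hA : ediam A ≤ 1) :
    ∃ W : ConvexBody (Space n), HasConstantWidth W 1 ∧ A ⊆ (W : Set (Space n)) ∧
      ediam (W : Set (Space n)) ≤ 1 := by
  obtain ⟨W, hAW, hW⟩ := exists_maximal_ediam_le_one A hA
  have hd : ediam W ≤ 1 := hW.prop
  have hclosed : IsClosed W := by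
    have : closure W ⊆ W := hW.le_of_ge (by simpa [ediam_closure] using hd) subset_closure
    exact isClosed_of_closure_subset this
  have hconv : Convex ℝ W := by
    have : convexHull ℝ W ⊆ W :=
      hW.le_of_ge (by simpa [convexHull_ediam] using hd) (subset_convexHull ℝ W)
    exact convexHull_eq_self.1 (this.antisymm (subset_convexHull ℝ W))
  have hbdd : Bornology.IsBounded W :=
    isBounded_iff_ediam_ne_top.2 (hd.trans_lt ENNReal.one_lt_top).ne
  have hcomp : IsCompact W := isCompact_of_isClosed_isBounded hclosed hbdd
  have hneW := hne.mono hAW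
  refine ⟨⟨W, hconv, hcomp, hneW⟩, fun u hu => ?_, hAW, hd⟩
  have hcont : ContinuousOn (fun x : Space n => (inner ℝ u x : ℝ)) W := by fun_prop
  obtain ⟨p, hpW, hp⟩ := hcomp.exists_isMaxOn hneW hcont
  have hmax : ∀ x ∈ W, (inner ℝ u x : ℝ) ≤ inner ℝ u p := fun x hx => hp hx
  have hpu := sub_mem_of_maximal_ediam_le_one hW hu hpW hmax
  have hval : (inner ℝ u (p - u) : ℝ) = inner ℝ u p - 1 := by
    rw [inner_sub_right, real_inner_self_eq_norm_sq, hu]; ring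
  have hS : IsGreatest ((fun x => (inner ℝ u x : ℝ)) '' W) (inner ℝ u p) :=
    ⟨⟨p, hpW, rfl⟩, by rintro _ ⟨x, hx, rfl⟩; exact hmax x hx⟩
  have hI : IsLeast ((fun x => (inner ℝ u x : ℝ)) '' W) (inner ℝ u p - 1) := by
    refine ⟨⟨p - u, hpu, hval⟩, ?_⟩
    rintro _ ⟨x, hx, rfl⟩
    have h1 := real_inner_le_norm u (p - x)
    have h2 := norm_sub_le_one_of_ediam_le_one hd hpW hx
    rw [inner_sub_right, hu, one_mul] at h1
    show (inner ℝ u p : ℝ) - 1 ≤ inner ℝ u x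
    linarith
  show sSup ((fun x => (inner ℝ u x : ℝ)) '' W) - sInf ((fun x => (inner ℝ u x : ℝ)) '' W) = 1
  rw [hS.csSup_eq, hI.csInf_eq]
  ring

/-- The distance between two points is bounded by the width in the direction joining them. -/
theorem HasConstantWidth.ediam_le_one {W : ConvexBody (Space n)} (hW : HasConstantWidth W 1) :
    ediam (W : Set (Space n)) ≤ 1 := by
  refine ediam_le fun x hx y hy => ?_
  rw [edist_dist, ENNReal.ofReal_le_one, dist_eq_norm]
  rcases eq_or_ne x y with rfl | hxy
  · simp
  have hpos : 0 < ‖x - y‖ := norm_pos_iff.2 (sub_ne_zero.2 hxy)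
  set u : Space n := ‖x - y‖⁻¹ • (x - y) with hu
  have hunorm : ‖u‖ = 1 := by
    rw [hu, norm_smul, norm_inv, norm_norm, inv_mul_cancel₀ hpos.ne']
  have himg : IsCompact ((fun x => (inner ℝ u x : ℝ)) '' (W : Set (Space n))) :=
    W.isCompact.image (by fun_prop)
  have h1 : (inner ℝ u x : ℝ) ≤ sSup ((fun x => (inner ℝ u x : ℝ)) '' (W : Set (Space n))) :=
    le_csSup himg.bddAbove ⟨x, hx, rfl⟩
  have h2 : sInf ((fun x => (inner ℝ u x : ℝ)) '' (W : Set (Space n))) ≤ (inner ℝ u y : ℝ) :=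
    csInf_le himg.bddBelow ⟨y, hy, rfl⟩
  have h3 : (inner ℝ u x : ℝ) - inner ℝ u y = ‖x - y‖ := by
    rw [← inner_sub_right, hu, inner_smul_left, real_inner_self_eq_norm_sq]
    simp only [conj_trivial]
    field_simp
  have h4 : sSup ((fun x => (inner ℝ u x : ℝ)) '' (W : Set (Space n))) -
    sInf ((fun x => (inner ℝ u x : ℝ)) '' (W : Set (Space n))) = 1 := hW u hunorm
  linarith

end ConstantWidth

end RieszCapacity

namespace RieszCapacity

open Filter Topology Metric Set
open scoped NNReal

/-! ### Weak compactness and semicontinuity -/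

section Energy

variable {n : ℕ} {lam : ℝ}

theorem rieszEnergy_eq_lintegral_prod (ν : ProbabilityMeasure (Space n)) :
    rieszEnergy lam ν = ∫⁻ p, (edist p.1 p.2) ^ (-lam) ∂(ν.prod ν : Measure (Space n × Space n)) := by
  rw [rieszEnergy, ProbabilityMeasure.toMeasure_prod, lintegral_prod]
  fun_prop

theorem supp_mem_ae (ν : ProbabilityMeasure (Space n)) :
    ∀ᵐ x ∂(ν : Measure (Space n)), x ∈ supp ν := Measure.support_mem_ae

theorem supp_nonempty (ν : ProbabilityMeasure (Space n)) : (supp ν).Nonempty :=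
  Measure.nonempty_support (IsProbabilityMeasure.ne_zero _)

theorem supp_subset_iff {K : Set (Space n)} (hK : IsClosed K) (ν : ProbabilityMeasure (Space n)) :
    supp ν ⊆ K ↔ (ν : Measure (Space n)) Kᶜ = 0 :=
  ⟨fun h => measure_mono_null (compl_subset_compl.2 h) Measure.measure_compl_support,
    fun h => Measure.support_subset_of_isClosed hK h⟩

/-- The Riesz kernel truncated at height `k`, as a bounded continuous function. -/
noncomputable def truncatedKernel (n : ℕ) (lam : ℝ) (k : ℕ) :
    BoundedContinuousFunction (Space n × Space n) ℝ≥0 :=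
  BoundedContinuousFunction.mkOfBound
    ⟨fun p => (min ((edist p.1 p.2) ^ (-lam)) k).toNNReal, by
      refine ENNReal.continuousOn_toNNReal.comp_continuous ?_ fun p => ?_
      · exact (ENNReal.continuous_rpow_const.comp continuous_edist).min continuous_const
      · exact ((min_le_right _ _).trans_lt (ENNReal.natCast_lt_top k)).ne⟩ k (by
    intro p q
    have h : ∀ a : ℝ≥0∞, (min a k).toNNReal ≤ (k : ℝ≥0) := fun a => by
      have := ENNReal.toNNReal_mono (ENNReal.natCast_ne_top k) (min_le_right a k)
      simpa using this
    rw [NNReal.dist_eq, abs_le]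
    have h1 := h ((edist p.1 p.2) ^ (-lam))
    have h2 := h ((edist q.1 q.2) ^ (-lam))
    simp only [ContinuousMap.coe_mk]
    rw [← NNReal.coe_le_coe] at h1 h2
    simp only [NNReal.coe_natCast] at h1 h2
    constructor <;> linarith [NNReal.coe_nonneg (min ((edist p.1 p.2) ^ (-lam)) k).toNNReal,
      NNReal.coe_nonneg (min ((edist q.1 q.2) ^ (-lam)) k).toNNReal])

theorem coe_truncatedKernel (k : ℕ) (p : Space n × Space n) :
    (truncatedKernel n lam k p : ℝ≥0∞) = min ((edist p.1 p.2) ^ (-lam)) k :=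
  ENNReal.coe_toNNReal ((min_le_right _ _).trans_lt (ENNReal.natCast_lt_top k)).ne

theorem iSup_truncatedKernel (p : Space n × Space n) :
    ⨆ k, (truncatedKernel n lam k p : ℝ≥0∞) = (edist p.1 p.2) ^ (-lam) := by
  simp_rw [coe_truncatedKernel]
  rw [← inf_iSup_eq, ENNReal.iSup_natCast, inf_top_eq]

/-- The Riesz energy is lower semicontinuous for weak convergence. -/
theorem lowerSemicontinuous_rieszEnergy :
    LowerSemicontinuous (rieszEnergy lam : ProbabilityMeasure (Space n) → ℝ≥0∞) := by
  have h : (rieszEnergy lam : ProbabilityMeasure (Space n) → ℝ≥0∞) = fun ν => ⨆ k : ℕ,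
      ∫⁻ p, truncatedKernel n lam k p ∂(ν.prod ν : Measure (Space n × Space n)) := by
    funext ν
    rw [rieszEnergy_eq_lintegral_prod, ← lintegral_iSup]
    · simp_rw [iSup_truncatedKernel]
    · exact fun k => (truncatedKernel n lam k).continuous.measurable.coe_nnreal_ennreal
    · intro k l hkl p
      simp only [coe_truncatedKernel]
      gcongr
  rw [h]
  -- Each truncated energy is weakly continuous, because `ν ↦ ν ⊗ ν` is.
  refine lowerSemicontinuous_iSup fun k => Continuous.lowerSemicontinuous ?_
  exact (ProbabilityMeasure.continuous_lintegral_boundedContinuousFunction _).comp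
    (ProbabilityMeasure.continuous_prod.comp (continuous_id.prodMk continuous_id))

/-- The measures supported in a compact set form a compact set. -/
theorem isCompact_supp_subset {K : Set (Space n)} (hK : IsCompact K) :
    IsCompact {ν : ProbabilityMeasure (Space n) | supp ν ⊆ K} := by
  -- Prokhorov's theorem with a constant compact set and zero mass allowed outside it.
  have h := isCompact_setOfPred_probabilityMeasure_mass_eq_compl_isCompact_le (E := Space n)
    (u := fun _ => 0) (K := fun _ => K) tendsto_const_nhds (fun _ => hK) (Or.inl inferInstance)
  convert h using 1
  ext ν
  rw [mem_ofPred_eq, mem_ofPred_eq, supp_subset_iff hK.isClosed, forall_const, nonpos_iff_eq_zero,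
    ProbabilityMeasure.null_iff_toMeasure_null]

/-- Charging a given open set is an open condition. -/
theorem eventually_inter_supp_nonempty {ν : ProbabilityMeasure (Space n)} {U : Set (Space n)}
    (hU : IsOpen U) {x : Space n} (hxU : x ∈ U) (hx : x ∈ supp ν) :
    ∀ᶠ ρ in 𝓝 ν, (U ∩ supp ρ).Nonempty := by
  have hpos : 0 < (ν : Measure (Space n)) U :=
    (Measure.mem_support_iff_forall x).1 hx U (hU.mem_nhds hxU)
  have hlim : (ν : Measure (Space n)) U ≤
      (𝓝 ν).liminf fun ρ : ProbabilityMeasure (Space n) => (ρ : Measure (Space n)) U :=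
    ProbabilityMeasure.le_liminf_measure_open_of_tendsto (μs := fun ρ => ρ) tendsto_id hU
  filter_upwards [eventually_lt_of_lt_liminf (hpos.trans_le hlim)] with ρ hρ
  exact Measure.nonempty_inter_support_of_pos hρ

/-- Two support points more than `r` apart have neighbourhoods whose points stay more than `r`
apart, and nearby measures still charge both. -/
theorem isClosed_ediam_supp_le (r : ℝ≥0∞) :
    IsClosed {ν : ProbabilityMeasure (Space n) | ediam (supp ν) ≤ r} := by
  refine isOpen_compl_iff.1 (isOpen_iff_eventually.2 fun ν hν => ?_)
  rw [mem_compl_iff, mem_ofPred_eq] at hν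
  obtain ⟨x, hx, y, hy, hxy⟩ : ∃ x ∈ supp ν, ∃ y ∈ supp ν, r < edist x y := by
    by_contra! h
    exact hν (ediam_le h)
  have hopen : IsOpen {p : Space n × Space n | r < edist p.1 p.2} :=
    isOpen_lt continuous_const continuous_edist
  obtain ⟨U, V, hU, hV, hxU, hyV, hUV⟩ := isOpen_prod_iff.1 hopen x y hxy
  filter_upwards [eventually_inter_supp_nonempty hU hxU hx,
    eventually_inter_supp_nonempty hV hyV hy] with ρ hρU hρV
  obtain ⟨x', hx'U, hx'⟩ := hρU
  obtain ⟨y', hy'V, hy'⟩ := hρV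
  have h1 : (x', y') ∈ {p : Space n × Space n | r < edist p.1 p.2} := hUV (mk_mem_prod hx'U hy'V)
  rw [mem_ofPred_eq] at h1
  rw [mem_compl_iff, mem_ofPred_eq]
  exact fun hρ => h1.not_ge ((edist_le_ediam_of_mem hx' hy').trans hρ)

/-! ### Scaling and finiteness of the energy -/

/-- Effect of a homothety on the support and the Riesz energy of a measure. -/
theorem exists_homothety (ν : ProbabilityMeasure (Space n)) {c : ℝ} (hc : 0 < c) (a : Space n) :
    ∃ ρ : ProbabilityMeasure (Space n), supp ρ ⊆ (fun x => c • (x - a)) '' supp ν ∧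
      rieszEnergy lam ρ = ENNReal.ofReal c ^ (-lam) * rieszEnergy lam ν := by
  let f : Space n ≃ₜ Space n := (Homeomorph.subRight a).trans (Homeomorph.smulOfNeZero c hc.ne')
  have hf : ∀ x, f x = c • (x - a) := fun x => rfl
  have hfm : Measurable f := f.continuous.measurable
  refine ⟨ν.map hfm.aemeasurable, ?_, ?_⟩
  · have hcl : IsClosed (f '' supp ν) := f.isClosedMap _ Measure.isClosed_support
    show supp _ ⊆ f '' supp ν
    rw [supp_subset_iff hcl, ProbabilityMeasure.toMeasure_map,
      Measure.map_apply hfm hcl.measurableSet.compl, preimage_compl, f.injective.preimage_image]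
    exact Measure.measure_compl_support
  · have hk : ∀ x y, edist (f x) (f y) ^ (-lam) = ENNReal.ofReal c ^ (-lam) * edist x y ^ (-lam) := by
      intro x y
      have : edist (f x) (f y) = ENNReal.ofReal c * edist x y := by
        rw [hf, hf, edist_smul₀, edist_sub_right, ENNReal.smul_def, smul_eq_mul]
        congr 1
        rw [ENNReal.ofReal, Real.nnnorm_of_nonneg hc.le, Real.toNNReal_of_nonneg hc.le]
      rw [this, ENNReal.mul_rpow_of_ne_top ENNReal.ofReal_ne_top (edist_ne_top _ _)]
    have hc' : ENNReal.ofReal c ^ (-lam) ≠ ∞ := by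
      rw [ENNReal.ofReal_rpow_of_pos hc]; exact ENNReal.ofReal_ne_top
    unfold rieszEnergy
    rw [ProbabilityMeasure.toMeasure_map, f.measurableEmbedding.lintegral_map]
    simp_rw [f.measurableEmbedding.lintegral_map, hk]
    simp_rw [lintegral_const_mul' _ _ hc']

/-- Positivity of the energy makes the scaling argument strict. -/
theorem one_le_rieszEnergy (hlam : 0 < lam) {ν : ProbabilityMeasure (Space n)}
    (hν : ediam (supp ν) ≤ 1) : 1 ≤ rieszEnergy lam ν := by
  calc (1 : ℝ≥0∞) = ∫⁻ _, ∫⁻ _, 1 ∂(ν : Measure (Space n)) ∂(ν : Measure (Space n)) := by simp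
    _ ≤ rieszEnergy lam ν := by
      refine lintegral_mono_ae ?_
      filter_upwards [supp_mem_ae ν] with x hx
      refine lintegral_mono_ae ?_
      filter_upwards [supp_mem_ae ν] with y hy
      rw [ENNReal.rpow_neg, ENNReal.one_le_inv]
      exact ENNReal.rpow_le_one ((edist_le_ediam_of_mem hx hy).trans hν) hlam.le

/-- Excludes diameter `0`, where no dilation could help. -/
theorem rieszEnergy_eq_top_of_subsingleton (hlam : 0 < lam) {ν : ProbabilityMeasure (Space n)}
    (hν : (supp ν).Subsingleton) : rieszEnergy lam ν = ∞ := by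
  refine top_le_iff.1 ?_
  calc ∞ = ∫⁻ _, ∫⁻ _, ∞ ∂(ν : Measure (Space n)) ∂(ν : Measure (Space n)) := by simp
    _ ≤ rieszEnergy lam ν := by
      refine lintegral_mono_ae ?_
      filter_upwards [supp_mem_ae ν] with x hx
      refine lintegral_mono_ae ?_
      filter_upwards [supp_mem_ae ν] with y hy
      rw [hν hx hy, edist_self, ENNReal.zero_rpow_of_neg (neg_lt_zero.2 hlam)]

/-- In polar coordinates the integrand is `r ^ (n - 1 - λ)`, integrable at `0` since `λ < n`. -/
theorem lintegral_ball_enorm_rpow_lt_top (hn : 1 ≤ n) (hlam_lt : lam < n) :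
    ∫⁻ z in ball (0 : Space n) 1, ‖z‖ₑ ^ (-lam) < ∞ := by
  have : Nonempty (Fin n) := ⟨⟨0, hn⟩⟩
  have hint : IntegrableOn (fun z : Space n => ‖z‖ ^ (-lam)) (ball 0 1) := by
    refine (integrableOn_fun_norm_addHaar (E := Space n) volume (f := fun r => r ^ (-lam))).2 ?_
    have h : IntegrableOn (fun y : ℝ => y ^ ((n : ℝ) - 1 - lam)) (Ioo 0 1) :=
      (intervalIntegral.integrableOn_Ioo_rpow_iff one_pos).2 (by linarith)
    refine h.congr_fun (fun y hy => ?_) measurableSet_Ioo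
    simp only [finrank_euclideanSpace, Fintype.card_fin, smul_eq_mul]
    rw [sub_eq_add_neg, Real.rpow_add hy.1, ← Real.rpow_natCast, Nat.cast_sub hn, Nat.cast_one]
  refine lt_of_eq_of_lt (lintegral_congr_ae ?_) hint.lintegral_lt_top
  filter_upwards [ae_restrict_of_ae (Measure.ae_ne volume (0 : Space n))] with z hz
  rw [← ofReal_norm, ENNReal.ofReal_rpow_of_pos (norm_pos_iff.2 hz)]

/-- The uniform measure on a ball of radius `1/2` has finite Riesz energy for `λ < n`. -/
theorem exists_rieszEnergy_lt_top (hn : 1 ≤ n) (hlam_lt : lam < n) :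
    ∃ ν : ProbabilityMeasure (Space n), supp ν ⊆ closedBall 0 (1 / 2) ∧ ediam (supp ν) ≤ 1 ∧
      rieszEnergy lam ν < ∞ := by
  set B : Set (Space n) := ball 0 (1 / 2) with hB
  have hB0 : volume B ≠ 0 := (measure_ball_pos _ _ (by norm_num)).ne'
  have hBt : volume B ≠ ∞ := measure_ball_lt_top.ne
  let m : Measure (Space n) := (volume B)⁻¹ • volume.restrict B
  have hm : IsProbabilityMeasure m := ⟨by simp [m, ENNReal.inv_mul_cancel hB0 hBt]⟩
  have hsupp : supp (⟨m, hm⟩ : ProbabilityMeasure (Space n)) ⊆ closedBall 0 (1 / 2) := by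
    refine (supp_subset_iff isClosed_closedBall _).2 ?_
    have : volume.restrict B (closedBall (0 : Space n) (1 / 2))ᶜ = 0 := by
      rw [Measure.restrict_apply isClosed_closedBall.measurableSet.compl]
      have : (closedBall (0 : Space n) (1 / 2))ᶜ ∩ B = ∅ := by
        ext z
        simp only [hB, mem_inter_iff, mem_compl_iff, mem_closedBall, mem_ball, mem_empty_iff_false]
        exact iff_false_intro fun h => h.1 h.2.le
      rw [this, measure_empty]
    show ((volume B)⁻¹ • volume.restrict B) _ = 0
    rw [Measure.smul_apply, this, smul_zero]
  refine ⟨⟨m, hm⟩, hsupp, ?_, ?_⟩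
  · refine (ediam_mono hsupp).trans (ediam_le fun x hx y hy => ?_)
    rw [edist_dist, ENNReal.ofReal_le_one]
    have := dist_triangle_right x y 0
    rw [mem_closedBall] at hx hy
    linarith
  set K : ℝ≥0∞ := ∫⁻ z in ball (0 : Space n) 1, ‖z‖ₑ ^ (-lam) with hK
  have hKt : K < ∞ := lintegral_ball_enorm_rpow_lt_top hn hlam_lt
  have hinner : ∀ x ∈ B, ∫⁻ y in B, (edist x y) ^ (-lam) ≤ K := by
    intro x hx
    -- Translating by `x` carries the half-ball integral into the unit ball around the singularity,
    -- a bound uniform in `x`.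
    rw [← lintegral_indicator measurableSet_ball, hK, ← lintegral_indicator measurableSet_ball,
      ← lintegral_sub_right_eq_self ((ball (0 : Space n) 1).indicator fun z => ‖z‖ₑ ^ (-lam)) x]
    refine lintegral_mono fun y => ?_
    by_cases hy : y ∈ B
    · have hyx : y - x ∈ ball (0 : Space n) 1 := by
        rw [hB, mem_ball_zero_iff] at hx hy
        rw [mem_ball_zero_iff]
        linarith [norm_sub_le y x]
      rw [indicator_of_mem hy, indicator_of_mem hyx, edist_comm, edist_eq_enorm_sub]
    · rw [indicator_of_notMem hy]
      exact zero_le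
  show ∫⁻ x, ∫⁻ y, (edist x y) ^ (-lam) ∂m ∂m < ∞
  have hle : ∀ᵐ x ∂m, ∫⁻ y, (edist x y) ^ (-lam) ∂m ≤ (volume B)⁻¹ * K := by
    refine Measure.ae_smul_measure ?_ _
    filter_upwards [ae_restrict_mem measurableSet_ball] with x hx
    rw [lintegral_smul_measure, smul_eq_mul]
    gcongr
    exact hinner x hx
  refine (lintegral_mono_ae hle).trans_lt ?_
  rw [lintegral_const, measure_univ, mul_one]
  exact ENNReal.mul_lt_top (ENNReal.inv_lt_top.2 (pos_iff_ne_zero.2 hB0)) hKt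

theorem limitEnergy_of_ediam_le {ν : ProbabilityMeasure (Space n)} (hν : ediam (supp ν) ≤ 1) :
    limitEnergy lam ν = rieszEnergy lam ν := if_pos hν

/-! ### Minimisers and capacities -/

/-- Equilibrium measures exist on nonempty compact sets. -/
theorem exists_isEquilibriumMeasure {K : Set (Space n)} (hK : IsCompact K) (hne : K.Nonempty) :
    ∃ μ : ProbabilityMeasure (Space n), IsEquilibriumMeasure lam K μ := by
  obtain ⟨x, hx⟩ := hne
  have hmem : supp (⟨Measure.dirac x, inferInstance⟩ : ProbabilityMeasure (Space n)) ⊆ K := by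
    refine (supp_subset_iff hK.isClosed _).2 ?_
    simp [hK.isClosed.measurableSet, hx]
  obtain ⟨μ, hμ, hmin⟩ := LowerSemicontinuousOn.exists_isMinOn ⟨_, hmem⟩ (isCompact_supp_subset hK)
    ((lowerSemicontinuous_rieszEnergy (n := n) (lam := lam)).lowerSemicontinuousOn _)
  exact ⟨μ, hμ, fun ρ hρ => hmin hρ⟩

/-- The limiting energy has a minimizer, of finite energy. -/
theorem exists_minimizer_limitEnergy (hn : 1 ≤ n) (hlam_lt : lam < n) :
    ∃ μ : ProbabilityMeasure (Space n), ediam (supp μ) ≤ 1 ∧ rieszEnergy lam μ < ∞ ∧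
      ∀ ν : ProbabilityMeasure (Space n), ediam (supp ν) ≤ 1 →
        rieszEnergy lam μ ≤ rieszEnergy lam ν := by
  obtain ⟨ν₀, hν₀, hν₀d, hν₀t⟩ := exists_rieszEnergy_lt_top hn hlam_lt
  have hcomp : IsCompact ({ν : ProbabilityMeasure (Space n) | supp ν ⊆ closedBall 0 1} ∩
      {ν | ediam (supp ν) ≤ 1}) :=
    (isCompact_supp_subset (isCompact_closedBall _ _)).inter_right (isClosed_ediam_supp_le 1)
  obtain ⟨μ, ⟨-, hμ⟩, hmin⟩ := LowerSemicontinuousOn.exists_isMinOn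
    ⟨ν₀, mem_inter (hν₀.trans (closedBall_subset_closedBall (by norm_num))) hν₀d⟩ hcomp
    ((lowerSemicontinuous_rieszEnergy (n := n) (lam := lam)).lowerSemicontinuousOn _)
  have hall : ∀ ν : ProbabilityMeasure (Space n), ediam (supp ν) ≤ 1 →
      rieszEnergy lam μ ≤ rieszEnergy lam ν := by
    intro ν hν
    obtain ⟨a, ha⟩ := supp_nonempty ν
    -- Ratio `1` gives a translation; moving a support point to `0` places the support in the unit
    -- ball.
    obtain ⟨ρ, hρ, hρe⟩ := exists_homothety (lam := lam) ν one_pos a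
    rw [ENNReal.ofReal_one, ENNReal.one_rpow, one_mul] at hρe
    rw [← hρe]
    refine hmin (mem_inter (fun z hz => ?_) ((ediam_mono hρ).trans (ediam_le ?_)))
    · obtain ⟨x, hx, rfl⟩ := hρ hz
      simpa using norm_sub_le_one_of_ediam_le_one hν hx ha
    · rintro _ ⟨x, hx, rfl⟩ _ ⟨y, hy, rfl⟩
      simpa using (edist_le_ediam_of_mem hx hy).trans hν
  exact ⟨μ, hμ, (hall _ hν₀d).trans_lt hν₀t, hall⟩

/-- By scaling, a minimizer of finite energy has support of diameter exactly `1`. -/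
theorem ediam_supp_eq_one_of_minimizer (hlam : 0 < lam) {μ : ProbabilityMeasure (Space n)}
    (hμ : ediam (supp μ) ≤ 1) (hfin : rieszEnergy lam μ < ∞)
    (hmin : ∀ ν : ProbabilityMeasure (Space n), ediam (supp ν) ≤ 1 →
      rieszEnergy lam μ ≤ rieszEnergy lam ν) : ediam (supp μ) = 1 := by
  refine hμ.antisymm (not_lt.1 fun hlt => ?_)
  have hd0 : ediam (supp μ) ≠ 0 := fun h =>
    hfin.ne (rieszEnergy_eq_top_of_subsingleton hlam (ediam_eq_zero_iff.1 h))
  have hdt : ediam (supp μ) ≠ ∞ := hlt.ne_top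
  set d : ℝ := (ediam (supp μ)).toReal with hd
  have hdpos : 0 < d := ENNReal.toReal_pos hd0 hdt
  have hd1 : d < 1 := by
    have := (ENNReal.toReal_lt_toReal hdt ENNReal.one_ne_top).2 hlt
    simpa using this
  -- Dilation by `1 / d` restores diameter at most `1` and multiplies the energy by `d ^ λ < 1`.
  obtain ⟨ρ, hρ, hρe⟩ := exists_homothety (lam := lam) μ (inv_pos.2 hdpos) 0
  have hρd : ediam (supp ρ) ≤ 1 := by
    refine (ediam_mono hρ).trans (ediam_le ?_)
    rintro _ ⟨x, hx, rfl⟩ _ ⟨y, hy, rfl⟩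
    have hxy : dist x y ≤ d := by
      rw [hd, dist_edist]
      exact ENNReal.toReal_mono hdt (edist_le_ediam_of_mem hx hy)
    rw [edist_dist, ENNReal.ofReal_le_one, dist_smul₀, dist_sub_right, norm_inv,
      Real.norm_of_nonneg hdpos.le, inv_mul_le_iff₀ hdpos, mul_one]
    exact hxy
  have h1 := hmin ρ hρd
  have hlt1 : ENNReal.ofReal d⁻¹ ^ (-lam) < 1 := by
    rw [ENNReal.ofReal_rpow_of_pos (inv_pos.2 hdpos), ENNReal.ofReal_lt_one, Real.inv_rpow hdpos.le,
      Real.rpow_neg hdpos.le, inv_inv]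
    exact Real.rpow_lt_one hdpos.le hd1 hlam
  have hE0 : rieszEnergy lam μ ≠ 0 := (one_pos.trans_le (one_le_rieszEnergy hlam hμ)).ne'
  rw [hρe] at h1
  exact h1.not_gt (by simpa using (ENNReal.mul_lt_mul_iff_left hE0 hfin.ne).2 hlt1)

theorem IsEquilibriumMeasure.capacity_eq {A : Set (Space n)} {μ : ProbabilityMeasure (Space n)}
    (hμ : IsEquilibriumMeasure lam A μ) : capacity lam A = (rieszEnergy lam μ)⁻¹ :=
  congrArg _ (le_antisymm (iInf₂_le μ hμ.1) (le_iInf₂ hμ.2))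

theorem iInf_limitEnergy_eq {μ : ProbabilityMeasure (Space n)} (hμ : ediam (supp μ) ≤ 1)
    (hmin : ∀ ν : ProbabilityMeasure (Space n), ediam (supp ν) ≤ 1 →
      rieszEnergy lam μ ≤ rieszEnergy lam ν) :
    ⨅ ν : ProbabilityMeasure (Space n), limitEnergy lam ν = rieszEnergy lam μ := by
  refine le_antisymm ((iInf_le _ μ).trans_eq (limitEnergy_of_ediam_le hμ)) (le_iInf fun ν => ?_)
  by_cases hν : ediam (supp ν) ≤ 1
  · exact (hmin ν hν).trans_eq (limitEnergy_of_ediam_le hν).symm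
  · rw [limitEnergy, if_neg hν]
    exact le_top

theorem iSup_capacity_eq {μ : ProbabilityMeasure (Space n)} (hμ : ediam (supp μ) ≤ 1)
    (hmin : ∀ ν : ProbabilityMeasure (Space n), ediam (supp ν) ≤ 1 →
      rieszEnergy lam μ ≤ rieszEnergy lam ν) :
    ⨆ (A : Set (Space n)) (_ : ediam A ≤ 1), capacity lam A = (rieszEnergy lam μ)⁻¹ := by
  refine le_antisymm (iSup₂_le fun A hA => ENNReal.inv_le_inv.2 (le_iInf₂ fun ν hν => ?_)) ?_
  · exact hmin ν ((ediam_mono hν).trans hA)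
  · exact le_iSup₂_of_le (supp μ) hμ (ENNReal.inv_le_inv.2 (iInf₂_le μ Subset.rfl))

end Energy

end RieszCapacity

theorem lemma4p1 (n : ℕ) (hn : 1 ≤ n) (lam : ℝ) (hlam_pos : 0 < lam) (hlam_lt : lam < n) :
    -- the infimum is the reciprocal of the supremum
    (⨅ ν : ProbabilityMeasure (RieszCapacity.Space n), RieszCapacity.limitEnergy lam ν) =
        (⨆ (A : Set (RieszCapacity.Space n)) (_ : Metric.ediam A ≤ 1),
          RieszCapacity.capacity lam A)⁻¹ ∧
    -- both are attained
    (∃ μ : ProbabilityMeasure (RieszCapacity.Space n),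
      RieszCapacity.limitEnergy lam μ =
          (⨅ ν : ProbabilityMeasure (RieszCapacity.Space n), RieszCapacity.limitEnergy lam ν) ∧
      Metric.ediam (RieszCapacity.supp μ) = 1 ∧
      ∃ W : ConvexBody (RieszCapacity.Space n),
        RieszCapacity.HasConstantWidth W 1 ∧
        RieszCapacity.supp μ ⊆ (W : Set (RieszCapacity.Space n)) ∧
        Metric.ediam (W : Set (RieszCapacity.Space n)) ≤ 1 ∧
        RieszCapacity.capacity lam (W : Set (RieszCapacity.Space n)) =
          ⨆ (A : Set (RieszCapacity.Space n)) (_ : Metric.ediam A ≤ 1),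
            RieszCapacity.capacity lam A) ∧
    -- the converse
    (∀ W : ConvexBody (RieszCapacity.Space n),
      RieszCapacity.HasConstantWidth W 1 →
      (∀ W' : ConvexBody (RieszCapacity.Space n), RieszCapacity.HasConstantWidth W' 1 →
        RieszCapacity.capacity lam (W' : Set (RieszCapacity.Space n)) ≤
          RieszCapacity.capacity lam (W : Set (RieszCapacity.Space n))) →
      (∃ μ : ProbabilityMeasure (RieszCapacity.Space n),
        RieszCapacity.IsEquilibriumMeasure lam (W : Set (RieszCapacity.Space n)) μ) ∧
      ∀ μ : ProbabilityMeasure (RieszCapacity.Space n),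
        RieszCapacity.IsEquilibriumMeasure lam (W : Set (RieszCapacity.Space n)) μ →
        RieszCapacity.limitEnergy lam μ =
          ⨅ ν : ProbabilityMeasure (RieszCapacity.Space n), RieszCapacity.limitEnergy lam ν) := by
  obtain ⟨μ, hμ, hfin, hmin⟩ :=
    RieszCapacity.exists_minimizer_limitEnergy (n := n) (lam := lam) hn hlam_lt
  have hInf : (⨅ ν : ProbabilityMeasure (RieszCapacity.Space n), RieszCapacity.limitEnergy lam ν) =
      RieszCapacity.rieszEnergy lam μ :=
    RieszCapacity.iInf_limitEnergy_eq hμ hmin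
  have hSup := RieszCapacity.iSup_capacity_eq hμ hmin
  -- The global minimiser is an equilibrium measure on any admissible set containing its support.
  have hle : ∀ {A : Set (RieszCapacity.Space n)}, Metric.ediam A ≤ 1 →
      RieszCapacity.supp μ ⊆ A →
      RieszCapacity.capacity lam A = (RieszCapacity.rieszEnergy lam μ)⁻¹ := fun hA hsub =>
    RieszCapacity.IsEquilibriumMeasure.capacity_eq
      ⟨hsub, fun ρ hρ => hmin ρ ((Metric.ediam_mono hρ).trans hA)⟩
  obtain ⟨W₀, hW₀, hsub, hd⟩ :=
    RieszCapacity.exists_constantWidth_superset (RieszCapacity.supp_nonempty μ) hμ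
  refine ⟨by rw [hInf, hSup, inv_inv], ⟨μ, ?_, ?_, W₀, hW₀, hsub, hd, ?_⟩, fun W hW hmax => ⟨?_, ?_⟩⟩
  · rw [hInf, RieszCapacity.limitEnergy_of_ediam_le hμ]
  · exact RieszCapacity.ediam_supp_eq_one_of_minimizer hlam_pos hμ hfin hmin
  · rw [hSup, hle hd hsub]
  · exact RieszCapacity.exists_isEquilibriumMeasure W.isCompact W.nonempty
  · intro ρ hρ
    have hρd := (Metric.ediam_mono hρ.1).trans hW.ediam_le_one
    -- Comparison with the single body `W₀` suffices, since it already has the largest possible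
    -- capacity.
    have h := hmax W₀ hW₀
    rw [hle hd hsub, hρ.capacity_eq, ENNReal.inv_le_inv] at h
    rw [hInf, RieszCapacity.limitEnergy_of_ediam_le hρd]
    exact h.antisymm (hmin ρ hρd)
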